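/- Let $P_{X,Y}$ be a probability measure on $\mathbb{R}^2$ with a strictly positive density $p(x,y)$ such that $p(x):=\int p(x,y)\,dy$ is finite for every $x$, and such that the joint, marginal and conditional log densities $\log p(x,y)$, $\log p(x)$ and $\log p(y\mid x)=\log\frac{p(x,y)}{p(x)}$ are differentiable. Write $s_x(x,y)=\partial_x\log p(x,y)$, $s_y(x,y)=\partial_y\log p(x,y)$ and $s_x(x)=\frac{d}{dx}\log p(x)$. Let $v=v(y,x)$ be a continuous function on $\mathbb{R}^2$ whose partial derivative $\partial_y v$ exists everywhere and is continuous on $\mathbb{R}^2$, and which satisfies $|v(y,x)|\le a(x)|y|+b(x)$ for all $x,y$, for some non-negative locally integrable functions $a,b:\mathbb{R}\to\mathbb{R}$. A bijective structural causal model (SCM) consists of a measurable function $f:\mathbb{R}^2\to\mathbb{R}$ such that $f_x=f(x,\cdot)$ is a bijection of $\mathbb{R}$ for each $x$, a probability law $P_X$ of the cause and a probability law $P_\epsilon$ of the noise. It represents the joint law of $(X,f(X,\epsilon))$, where $X\sim P_X$ and $\epsilon\sim P_\epsilon$ are independent. It has velocity $v$ if $(x,x',y)\mapsto f_{x'}(f_x^{-1}(y))$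 is continuous and $$\frac{d}{dx'}f_{x'}(f_x^{-1}(y))\Big|_{x'=x}=v(y,x)\qquad\text{for all }(x,y)\in\mathbb{R}^2 .$$ Then $$s_x(x,y)=-\partial_y v(y,x)-v(y,x)\,s_y(x,y)+s_x(x)\qquad\text{for all }(x,y)\in\mathbb{R}^2$$ if and only if $P_{X,Y}$ is represented by a bijective SCM with velocity $v$ whose cause has the marginal density $p(x)$. -/

import Mathlib

open MeasureTheory

/-- The marginal density `p(x) = ∫ p(x, y) dy` of the cause. -/
noncomputable def marginalDensity (p : ℝ × ℝ → ℝ) (x : ℝ) : ℝ :=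
  ∫ y, p (x, y)

/-- The conditional density `p(y | x) = p(x, y) / p(x)`, as a function of `(x, y)`. -/
noncomputable def conditionalDensity (p : ℝ × ℝ → ℝ) (z : ℝ × ℝ) : ℝ :=
  p z / marginalDensity p z.1

/-- `p` is the density of `P` on `ℝ²`; it is strictly positive (full support), its sections
`p(x, ·)` are integrable, so that the marginal density is a genuine integral at each `x`, and the
joint, marginal and conditional log densities are differentiable. -/
structure IsScoreDensity (P : Measure (ℝ × ℝ)) (p : ℝ × ℝ → ℝ) : Prop where
  eq_withDensity : P = volume.withDensity (fun z => ENNReal.ofReal (p z))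
  pos : ∀ z, 0 < p z
  integrable_section : ∀ x, Integrable (fun y => p (x, y))
  differentiable_log_joint : Differentiable ℝ (fun z => Real.log (p z))
  differentiable_log_marginal : Differentiable ℝ (fun x => Real.log (marginalDensity p x))
  differentiable_log_conditional : Differentiable ℝ (fun z => Real.log (conditionalDensity p z))

/-- `s_x(x, y) = ∂_x log p(x, y)`. -/
noncomputable def jointScoreX (p : ℝ × ℝ → ℝ) (x y : ℝ) : ℝ :=
  deriv (fun t => Real.log (p (t, y))) x

/-- `s_y(x, y) = ∂_y log p(x, y)`. -/
noncomputable def jointScoreY (p : ℝ × ℝ → ℝ) (x y : ℝ) : ℝ :=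
  deriv (fun t => Real.log (p (x, t))) y

/-- `s_x(x) = ∂_x log p(x)`. -/
noncomputable def marginalScore (p : ℝ × ℝ → ℝ) (x : ℝ) : ℝ :=
  deriv (fun t => Real.log (marginalDensity p t)) x

/-- Regularity of a velocity field `v(y, x)` (first the state `y`, then the cause `x`, which plays
the role of time): it is continuous, continuously differentiable in `y`, and grows at most linearly
in `y` with coefficients that are locally integrable in `x`. -/
structure IsRegularVelocity (v : ℝ → ℝ → ℝ) : Prop where
  continuous : Continuous (fun z : ℝ × ℝ => v z.1 z.2)
  differentiable : ∀ x, Differentiable ℝ (fun y => v y x)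
  continuous_deriv : Continuous (fun z : ℝ × ℝ => deriv (fun y => v y z.2) z.1)
  linear_growth : ∃ a b : ℝ → ℝ, (∀ x, 0 ≤ a x) ∧ (∀ x, 0 ≤ b x) ∧
    LocallyIntegrable a ∧ LocallyIntegrable b ∧ ∀ y x, |v y x| ≤ a x * |y| + b x

/-- A bijective structural causal model `Y = f(X, ε)` with `X` independent of `ε`: the tuple of
the mechanism `f`, the law of `X` and the law of `ε`. -/
structure BijectiveSCM where
  mechanism : ℝ → ℝ → ℝ
  measurable_mechanism : Measurable (fun z : ℝ × ℝ => mechanism z.1 z.2)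
  bijective_mechanism : ∀ x, Function.Bijective (mechanism x)
  causeLaw : Measure ℝ
  noiseLaw : Measure ℝ
  isProbabilityMeasure_causeLaw : IsProbabilityMeasure causeLaw
  isProbabilityMeasure_noiseLaw : IsProbabilityMeasure noiseLaw

namespace BijectiveSCM

/-- The law of `(X, Y) = (X, f(X, ε))`, where `X` and `ε` are independent. -/
noncomputable def jointLaw (M : BijectiveSCM) : Measure (ℝ × ℝ) :=
  (M.causeLaw.prod M.noiseLaw).map (fun z => (z.1, M.mechanism z.1 z.2))

/-- The SCM flow `φ_{x,x'}(y) = f_{x'}(f_x⁻¹(y))`. -/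
noncomputable def flow (M : BijectiveSCM) (x x' y : ℝ) : ℝ :=
  M.mechanism x' ((Equiv.ofBijective (M.mechanism x) (M.bijective_mechanism x)).symm y)

/-- The SCM has velocity `v`: its flow is continuous in `(x, x', y)` and, at each `(x, y)`,
`v(y, x)` is the derivative of `x' ↦ f_{x'}(f_x⁻¹(y))` at `x' = x`. -/
def HasVelocity (M : BijectiveSCM) (v : ℝ → ℝ → ℝ) : Prop :=
  Continuous (fun q : ℝ × ℝ × ℝ => M.flow q.1 q.2.1 q.2.2) ∧
    ∀ x y, HasDerivAt (fun x' => M.flow x x' y) (v y x) x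

end BijectiveSCM

/-! Factor p(x,y) = p(x) p(y|x). The score equation then becomes the continuity equation ∂_x log
p(y|x) + v ∂_y log p(y|x) + ∂_y v = 0. Linear growth makes y' = v(y,x) globally solvable, and its
flow g_x from time 0 consists of increasing bijections with Jacobian J = exp ∫ ∂_y v. Along a
trajectory, the left-hand side above is the derivative of log (p(g_x(e)|x) J), so the score equation
means that this product keeps its initial value p(e|0) (`score_eq_iff_transport`).

By change of variables, the map (x,e) ↦ (x, g_x(e)) then carries p(x) p(e|0) to P: the SCM has
mechanism g and noise density p(·|0). Conversely, the flow from 0 of any SCM with velocity v is such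
a g, with noise f_0(ε). Pulling P back along the injective fiber map gives a product measure, which
forces p(g_x(e)|x) J to be independent of x (`eq_of_prod_eq_withDensity`). -/

/-! ### Global existence and separation of solutions -/

/-- A globally defined solution of the differential equation `α'(t) = v(α(t), t)`. -/
def IsGlobalSolution (v : ℝ → ℝ → ℝ) (α : ℝ → ℝ) : Prop :=
  ∀ t, HasDerivAt α (v (α t) t) t

/-- The average of `∂_y v(·, x)` over the segment from `y₁` to `y₂`. -/
noncomputable def meanSlope (v : ℝ → ℝ → ℝ) (y₁ y₂ x : ℝ) : ℝ :=
  ∫ θ in (0 : ℝ)..1, deriv (fun y => v y x) (y₁ + θ * (y₂ - y₁))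

namespace IsGlobalSolution

theorem continuous {v : ℝ → ℝ → ℝ} {α : ℝ → ℝ} (hα : IsGlobalSolution v α) : Continuous α :=
  continuous_iff_continuousAt.2 fun t => (hα t).continuousAt

end IsGlobalSolution

namespace IsRegularVelocity

open Set Filter Topology

variable {v : ℝ → ℝ → ℝ}

theorem continuous_meanSlope (hv : IsRegularVelocity v) :
    Continuous (fun q : ℝ × ℝ × ℝ => meanSlope v q.1 q.2.1 q.2.2) := by
  unfold meanSlope
  refine intervalIntegral.continuous_parametric_intervalIntegral_of_continuous'
    (f := fun (q : ℝ × ℝ × ℝ) (θ : ℝ) =>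
      deriv (fun y => v y q.2.2) (q.1 + θ * (q.2.1 - q.1))) ?_ 0 1
  exact hv.continuous_deriv.comp (f := fun z : (ℝ × ℝ × ℝ) × ℝ =>
    (z.1.1 + z.2 * (z.1.2.1 - z.1.1), z.1.2.2)) (by fun_prop)

theorem mul_meanSlope (hv : IsRegularVelocity v) (y₁ y₂ x : ℝ) :
    (y₂ - y₁) * meanSlope v y₁ y₂ x = v y₂ x - v y₁ x := by
  have h := intervalIntegral.integral_unitInterval_deriv_eq_sub (𝕜 := ℝ) (f := fun y => v y x)
    (f' := deriv (fun y => v y x)) (z₀ := y₁) (z₁ := y₂ - y₁)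
    (Continuous.continuousOn <| hv.continuous_deriv.comp
      (f := fun t : ℝ => (y₁ + t • (y₂ - y₁), x)) (by fun_prop))
    (fun t _ => (hv.differentiable x _).hasDerivAt)
  simpa [meanSlope] using h

@[simp] theorem meanSlope_self (v : ℝ → ℝ → ℝ) (y x : ℝ) :
    meanSlope v y y x = deriv (fun y => v y x) y := by
  simp [meanSlope]

/-- Two solutions separate exponentially, at the rate given by the mean slope between them. -/
theorem sub_eq_mul_exp (hv : IsRegularVelocity v) {α β : ℝ → ℝ} (hα : IsGlobalSolution v α)
    (hβ : IsGlobalSolution v β) (s t : ℝ) :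
    β t - α t = (β s - α s) * Real.exp (∫ r in s..t, meanSlope v (α r) (β r) r) := by
  have hw : Continuous (fun r => meanSlope v (α r) (β r) r) :=
    hv.continuous_meanSlope.comp (f := fun r => (α r, β r, r))
      (hα.continuous.prodMk (hβ.continuous.prodMk continuous_id))
  -- The difference w = β - α solves the linear equation w' = m w, with m the mean slope; the
  -- integrating factor makes it constant.
  have hd : ∀ u, HasDerivAt (fun u => (β u - α u) *
      Real.exp (-∫ r in s..u, meanSlope v (α r) (β r) r)) 0 u := by
    intro u
    have h1 := ((hβ u).sub (hα u)).mul
      ((hw.integral_hasStrictDerivAt s u).hasDerivAt.neg.exp)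
    refine h1.congr_deriv ?_
    rw [← hv.mul_meanSlope (α u) (β u) u]
    simp only [Pi.sub_apply]
    ring
  have hc := is_const_of_deriv_eq_zero (fun u => (hd u).differentiableAt)
    (fun u => (hd u).deriv) t s
  simp only [intervalIntegral.integral_same, neg_zero, Real.exp_zero, mul_one] at hc
  rw [← hc, mul_assoc, ← Real.exp_add]
  simp

/-- On a compact rectangle, the velocity is Lipschitz in the state uniformly in time. -/
theorem exists_lipschitzOnWith (hv : IsRegularVelocity v) (T R : ℝ) :
    ∃ K : NNReal, ∀ t ∈ Icc (-T) T, LipschitzOnWith K (fun y => v y t) (Icc (-R) R) := by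
  obtain ⟨C, hC⟩ := ((isCompact_Icc (a := -R) (b := R)).prod
    (isCompact_Icc (a := -T) (b := T))).exists_bound_of_continuousOn
    hv.continuous_deriv.continuousOn
  refine ⟨C.toNNReal, fun t ht => ?_⟩
  refine Convex.lipschitzOnWith_of_nnnorm_deriv_le (fun y _ => hv.differentiable t y)
    (fun y hy => ?_) (convex_Icc _ _)
  rw [← NNReal.coe_le_coe, coe_nnnorm]
  exact (hC (y, t) ⟨hy, ht⟩).trans (Real.le_coe_toNNReal C)

/-- Solutions of the equation with the state truncated at level `R`. -/
theorem exists_truncated_solution (hv : IsRegularVelocity v) {T R : ℝ} (hR : 0 ≤ R) {t₀ : ℝ}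
    (ht₀ : t₀ ∈ Ioo (-T) T) (y₀ : ℝ) :
    ∃ α : ℝ → ℝ, α t₀ = y₀ ∧
      ∀ t ∈ Ioo (-T) T, HasDerivAt α (v (max (-R) (min R (α t))) t) t := by
  obtain ⟨K, hK⟩ := hv.exists_lipschitzOnWith T R
  obtain ⟨C, hC⟩ := ((isCompact_Icc (a := -R) (b := R)).prod
    (isCompact_Icc (a := -T) (b := T))).exists_bound_of_continuousOn
    hv.continuous.continuousOn
  have hmem : ∀ y : ℝ, max (-R) (min R y) ∈ Icc (-R) R := fun y =>
    ⟨le_max_left _ _, max_le (by linarith) (min_le_left _ _)⟩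
  have hlip : LipschitzWith 1 (fun y : ℝ => max (-R) (min R y)) :=
    (LipschitzWith.id.const_min R).const_max (-R)
  have hT : 0 < T := by linarith [ht₀.1, ht₀.2]
  -- The truncated field is bounded by C and Lipschitz, so a ball of radius C · 2T contains the
  -- solution for the whole interval.
  have hpl : IsPicardLindelof (fun t y => v (max (-R) (min R y)) t)
      (⟨t₀, Ioo_subset_Icc_self ht₀⟩ : Icc (-T) T) y₀ (C.toNNReal * (2 * T).toNNReal) 0
      C.toNNReal K :=
    { lipschitzOnWith := fun t ht => by
        have := (hK t ht).comp (hlip.lipschitzOnWith (s := Metric.closedBall y₀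
          (C.toNNReal * (2 * T).toNNReal))) (fun y _ => hmem y)
        rwa [mul_one] at this
      continuousOn := fun y _ => Continuous.continuousOn <|
        hv.continuous.comp (f := fun t : ℝ => (max (-R) (min R y), t)) (by fun_prop)
      norm_le := fun t ht y _ =>
        (hC (max (-R) (min R y), t) ⟨hmem y, ht⟩).trans (Real.le_coe_toNNReal C)
      mul_max_le := by
        simp only [NNReal.coe_mul, NNReal.coe_zero, sub_zero]
        gcongr
        rw [Real.coe_toNNReal _ (by linarith)]
        exact max_le (by linarith [ht₀.1]) (by linarith [ht₀.2]) }
  obtain ⟨α, h0, hα⟩ := hpl.exists_eq_forall_mem_Icc_hasDerivWithinAt₀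
  exact ⟨α, h0, fun t ht =>
    (hα t (Ioo_subset_Icc_self ht)).hasDerivAt (Icc_mem_nhds ht.1 ht.2)⟩

/-- The linear growth bound confines solutions on a bounded time interval. -/
theorem log_one_add_sq_le {V : ℝ → ℝ} {α a b : ℝ → ℝ} {T t₀ : ℝ} (ht₀ : t₀ ∈ Ioo (-T) T)
    (ha : ∀ t, 0 ≤ a t) (hb : ∀ t, 0 ≤ b t)
    (hai : LocallyIntegrable a) (hbi : LocallyIntegrable b)
    (hα : ∀ t ∈ Ioo (-T) T, HasDerivAt α (V t) t) (hV : ContinuousOn V (Ioo (-T) T))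
    (hbound : ∀ t, |V t| ≤ a t * |α t| + b t) {t : ℝ} (ht : t ∈ Ioo (-T) T) :
    Real.log (1 + α t ^ 2) ≤
      Real.log (1 + α t₀ ^ 2) + |∫ s in (-T)..T, 4 * (a s + b s)| := by
  have hint : ∀ c d : ℝ, IntervalIntegrable (fun s => 4 * (a s + b s)) volume c d := fun c d =>
    ((hai.integrableOn_isCompact isCompact_uIcc).intervalIntegrable.add
      (hbi.integrableOn_isCompact isCompact_uIcc).intervalIntegrable).const_mul 4
  have hsub : uIcc t₀ t ⊆ Ioo (-T) T := ordConnected_Ioo.uIcc_subset ht₀ ht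
  have hcα : ContinuousOn α (uIcc t₀ t) := fun s hs =>
    (hα s (hsub hs)).continuousAt.continuousWithinAt
  have hder : ∀ s ∈ uIcc t₀ t, HasDerivAt (fun s => Real.log (1 + α s ^ 2))
      (2 * α s * V s / (1 + α s ^ 2)) s := fun s hs => by
    have h := (((hα s (hsub hs)).pow 2).const_add 1).log
      (show 1 + α s ^ 2 ≠ 0 by positivity)
    simpa using h
  have hcont : ContinuousOn (fun s => 2 * α s * V s / (1 + α s ^ 2)) (uIcc t₀ t) :=
    ((continuousOn_const.mul hcα).mul (hV.mono hsub)).div (continuousOn_const.add (hcα.pow 2))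
      (fun s _ => by positivity)
  have hftc := intervalIntegral.integral_eq_sub_of_hasDerivAt hder hcont.intervalIntegrable
  -- The linear growth of V is absorbed by 1 + α², so direct integration replaces Grönwall. The
  -- constant 4 is not sharp.
  have hle : ∀ s, ‖2 * α s * V s / (1 + α s ^ 2)‖ ≤ 4 * (a s + b s) := fun s => by
    rw [Real.norm_eq_abs, abs_div, abs_of_pos (show 0 < 1 + α s ^ 2 by positivity),
      div_le_iff₀ (by positivity), abs_mul, abs_mul, abs_two]
    have h1 := mul_le_mul_of_nonneg_left (hbound s) (abs_nonneg (α s))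
    have h2 : α s ^ 2 = |α s| ^ 2 := (sq_abs _).symm
    rw [h2]
    nlinarith [ha s, hb s, mul_nonneg (ha s) (sq_nonneg |α s|),
      mul_nonneg (hb s) (sq_nonneg (|α s| - 1)), mul_nonneg (hb s) (sq_nonneg |α s|)]
  have h1 := intervalIntegral.norm_integral_le_abs_of_norm_le
    (μ := volume) (a := t₀) (b := t) (.of_forall hle) (hint _ _)
  have h2 : |∫ s in t₀..t, 4 * (a s + b s)| ≤ |∫ s in (-T)..T, 4 * (a s + b s)| := by
    refine intervalIntegral.abs_integral_mono_interval ?_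
      (.of_forall fun s => by simpa using add_nonneg (ha s) (hb s)) (hint _ _)
    exact uIoc_subset_uIoc_of_uIcc_subset_uIcc <| uIcc_subset_uIcc
      (Icc_subset_uIcc (Ioo_subset_Icc_self ht₀)) (Icc_subset_uIcc (Ioo_subset_Icc_self ht))
  rw [hftc] at h1
  have := (le_abs_self _).trans (h1.trans h2)
  linarith

/-- Truncation does not increase |y|, so the growth bound still applies and gives 1 + α² ≤ R, with R
independent of the truncation. As |α| ≤ 1 + α², the truncation is never active. -/
theorem exists_solution_Ioo (hv : IsRegularVelocity v) {T t₀ : ℝ} (ht₀ : t₀ ∈ Ioo (-T) T)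
    (y₀ : ℝ) :
    ∃ α : ℝ → ℝ, α t₀ = y₀ ∧ (∀ t ∈ Ioo (-T) T, HasDerivAt α (v (α t) t) t) ∧
      ∃ R, ∀ t ∈ Ioo (-T) T, α t ∈ Icc (-R) R := by
  obtain ⟨a, b, ha, hb, hai, hbi, hab⟩ := hv.linear_growth
  set R := Real.exp (Real.log (1 + y₀ ^ 2) + |∫ s in (-T)..T, 4 * (a s + b s)|) with hR
  obtain ⟨α, h0, hα⟩ := hv.exists_truncated_solution (R := R) (Real.exp_pos _).le ht₀ y₀
  have hclamp : ∀ y : ℝ, |max (-R) (min R y)| ≤ |y| := fun y => by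
    have : 0 < R := Real.exp_pos _
    rw [abs_le]
    refine ⟨?_, ?_⟩
    · rcases le_total R y with h | h
      · rw [min_eq_left h]
        exact (neg_nonpos.2 (abs_nonneg y)).trans (this.le.trans (le_max_right _ _))
      · rw [min_eq_right h]
        exact (neg_abs_le y).trans (le_max_right _ _)
    · exact max_le (by linarith [abs_nonneg y]) ((min_le_right _ _).trans (le_abs_self y))
  have hcα : ContinuousOn α (Ioo (-T) T) := fun s hs =>
    (hα s hs).continuousAt.continuousWithinAt
  have hmem : ∀ t ∈ Ioo (-T) T, |α t| ≤ R := fun t ht => by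
    have h := log_one_add_sq_le ht₀ ha hb hai hbi hα
      (hv.continuous.comp_continuousOn (f := fun t => (max (-R) (min R (α t)), t))
        ((continuousOn_const.sup (continuousOn_const.inf hcα)).prodMk continuousOn_id))
      (fun t => (hab _ t).trans (by have := mul_le_mul_of_nonneg_left (hclamp (α t)) (ha t); linarith)) ht
    rw [h0, Real.log_le_iff_le_exp (by positivity), ← hR] at h
    nlinarith [sq_abs (α t), sq_nonneg (|α t| - 1), sq_nonneg (|α t|)]
  refine ⟨α, h0, fun t ht => ?_, R, fun t ht => abs_le.1 (hmem t ht)⟩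
  have h := hα t ht
  rwa [min_eq_right (abs_le.1 (hmem t ht)).2, max_eq_right (abs_le.1 (hmem t ht)).1] at h

theorem exists_globalSolution (hv : IsRegularVelocity v) (t₀ y₀ : ℝ) :
    ∃ α : ℝ → ℝ, α t₀ = y₀ ∧ IsGlobalSolution v α := by
  have hex : ∀ T : ℝ, |t₀| < T → ∃ α : ℝ → ℝ, α t₀ = y₀ ∧
      (∀ t ∈ Ioo (-T) T, HasDerivAt α (v (α t) t) t) ∧
      ∃ R, ∀ t ∈ Ioo (-T) T, α t ∈ Icc (-R) R :=
    fun T hT => hv.exists_solution_Ioo (abs_lt.1 hT) y₀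
  choose! α h0 hα hR using hex
  have huniq : ∀ S T : ℝ, |t₀| < S → S ≤ T → EqOn (α S) (α T) (Ioo (-S) S) := by
    intro S T hS hST
    obtain ⟨R₁, hR₁⟩ := hR S hS
    obtain ⟨R₂, hR₂⟩ := hR T (hS.trans_le hST)
    have hsub : Ioo (-S) S ⊆ Ioo (-T) T := Ioo_subset_Ioo (neg_le_neg hST) hST
    obtain ⟨K, hK⟩ := hv.exists_lipschitzOnWith S (max R₁ R₂)
    refine ODE_solution_unique_of_mem_Ioo (v := fun t y => v y t)
      (s := fun _ => Icc (-max R₁ R₂) (max R₁ R₂)) (K := K) (t₀ := t₀)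
      (fun t ht => hK t (Ioo_subset_Icc_self ht)) (abs_lt.1 hS)
      (fun t ht => ⟨hα S hS t ht, Icc_subset_Icc (neg_le_neg (le_max_left _ _))
        (le_max_left _ _) (hR₁ t ht)⟩)
      (fun t ht => ⟨hα T (hS.trans_le hST) t (hsub ht), Icc_subset_Icc
        (neg_le_neg (le_max_right _ _)) (le_max_right _ _) (hR₂ t (hsub ht))⟩) ?_
    rw [h0 S hS, h0 T (hS.trans_le hST)]
  have hlt : ∀ t : ℝ, |t₀| < |t| + |t₀| + 1 := fun t => by linarith [abs_nonneg t]
  -- Solutions on nested intervals agree, so each time may use its own interval; near t all of them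
  -- match the one of half-length |t| + |t₀| + 2.
  refine ⟨fun t => α (|t| + |t₀| + 1) t, h0 _ (hlt t₀), fun t => ?_⟩
  have hlt' : |t₀| < |t| + |t₀| + 2 := by linarith [hlt t]
  have heq : ∀ s : ℝ, |s| < |t| + 1 → α (|s| + |t₀| + 1) s = α (|t| + |t₀| + 2) s :=
    fun s hs => huniq _ _ (hlt s) (by linarith) (abs_lt.1 (by linarith [abs_nonneg t₀]))
  have hd := hα _ hlt' t (abs_lt.1 (by linarith [abs_nonneg t₀]))
  rw [← heq t (by linarith)] at hd
  refine hd.congr_of_eventuallyEq ?_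
  filter_upwards [(continuous_abs.tendsto t).eventually_lt_const (lt_add_one |t|)] with s hs
  exact heq s hs

end IsRegularVelocity

/-! ### The global flow, its Jacobian and change of variables -/

/-- `g x e` is the value at time `x` of the solution started at `e` at time `0`, and every state
is reached at every time. -/
structure IsGlobalFlow (v : ℝ → ℝ → ℝ) (g : ℝ → ℝ → ℝ) : Prop where
  zero : ∀ e, g 0 e = e
  isGlobalSolution : ∀ e, IsGlobalSolution v (fun x => g x e)
  surjective : ∀ x, Function.Surjective (g x)

/-- Liouville's formula for the derivative of the flow with respect to its initial state. -/
noncomputable def flowJacobian (v g : ℝ → ℝ → ℝ) (x e : ℝ) : ℝ :=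
  Real.exp (∫ s in (0 : ℝ)..x, deriv (fun y => v y s) (g s e))

/-- The map `(x, e) ↦ (x, g x e)`. -/
def fiberMap (g : ℝ → ℝ → ℝ) (z : ℝ × ℝ) : ℝ × ℝ := (z.1, g z.1 z.2)

open Set Filter Topology

theorem IsRegularVelocity.exists_isGlobalFlow {v : ℝ → ℝ → ℝ} (hv : IsRegularVelocity v) :
    ∃ g, IsGlobalFlow v g := by
  choose α h0 hα using hv.exists_globalSolution 0
  refine ⟨fun x e => α e x, h0, hα, fun x y => ?_⟩
  -- To reach y at time x, follow the solution through (x, y) back to time 0; zero separation at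
  -- time 0 persists.
  obtain ⟨β, hβ, hsol⟩ := hv.exists_globalSolution x y
  refine ⟨β 0, ?_⟩
  have h := hv.sub_eq_mul_exp (hα (β 0)) hsol 0 x
  rw [h0, sub_self, zero_mul, hβ, sub_eq_zero] at h
  exact h.symm

/-- A family of functions that is increasing and continuous in the second variable and continuous
in the first variable is jointly continuous. -/
theorem continuous_uncurry_of_monotone {g : ℝ → ℝ → ℝ} (hmono : ∀ x, Monotone (g x))
    (hcont : ∀ x, Continuous (g x)) (hcont' : ∀ e, Continuous (fun x => g x e)) :
    Continuous (fun z : ℝ × ℝ => g z.1 z.2) := by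
  refine continuous_iff_continuousAt.2 fun ⟨x₀, e₀⟩ => ?_
  refine tendsto_order.2 ⟨fun c hc => ?_, fun c hc => ?_⟩
  -- At a point slightly left of e₀ the lower bound persists for nearby x, and monotonicity extends
  -- it to all larger states.
  · obtain ⟨e, he, hce⟩ := (((hcont x₀).tendsto e₀).eventually_const_lt hc
      |>.filter_mono nhdsWithin_le_nhds |>.and self_mem_nhdsWithin :
        ∀ᶠ e in 𝓝[<] e₀, c < g x₀ e ∧ e < e₀).exists.imp fun e h => h.symm
    have h1 := ((hcont' e).tendsto x₀).eventually_const_lt hce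
    filter_upwards [h1.prod_nhds (lt_mem_nhds he)] with z hz
    exact hz.1.trans_le (hmono _ hz.2.le)
  · obtain ⟨e, he, hce⟩ := (((hcont x₀).tendsto e₀).eventually_lt_const hc
      |>.filter_mono nhdsWithin_le_nhds |>.and self_mem_nhdsWithin :
        ∀ᶠ e in 𝓝[>] e₀, g x₀ e < c ∧ e₀ < e).exists.imp fun e h => h.symm
    have h1 := ((hcont' e).tendsto x₀).eventually_lt_const hce
    filter_upwards [h1.prod_nhds (gt_mem_nhds he)] with z hz
    exact (hmono _ hz.2.le).trans_lt hz.1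

/-- The fiberwise inverse of a continuous family of increasing functions is jointly continuous. -/
theorem continuous_uncurry_inverse_of_strictMono {g h : ℝ → ℝ → ℝ}
    (hmono : ∀ x, StrictMono (g x)) (hcont : ∀ e, Continuous (fun x => g x e))
    (hgh : ∀ x y, g x (h x y) = y) : Continuous (fun z : ℝ × ℝ => h z.1 z.2) := by
  refine continuous_iff_continuousAt.2 fun ⟨x₀, y₀⟩ => ?_
  have hfst : ∀ e, Tendsto (fun z : ℝ × ℝ => g z.1 e) (𝓝 (x₀, y₀)) (𝓝 (g x₀ e)) := fun e =>
    ((hcont e).comp continuous_fst).tendsto (x₀, y₀)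
  have hsnd : Tendsto (fun z : ℝ × ℝ => z.2) (𝓝 (x₀, y₀)) (𝓝 y₀) :=
    continuous_snd.tendsto (x₀, y₀)
  refine tendsto_order.2 ⟨fun c (hc : c < h x₀ y₀) => ?_, fun c (hc : h x₀ y₀ < c) => ?_⟩
  · have hlt : g x₀ c < y₀ := by simpa [hgh] using hmono x₀ hc
    filter_upwards [(hfst c).eventually_lt hsnd hlt] with z hz
    rw [← hgh z.1 z.2] at hz
    exact (hmono z.1).lt_iff_lt.1 hz
  · have hlt : y₀ < g x₀ c := by simpa [hgh] using hmono x₀ hc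
    filter_upwards [hsnd.eventually_lt (hfst c) hlt] with z hz
    rw [← hgh z.1 z.2] at hz
    exact (hmono z.1).lt_iff_lt.1 hz

namespace IsGlobalFlow

variable {v g : ℝ → ℝ → ℝ}

theorem sub_eq (hg : IsGlobalFlow v g) (hv : IsRegularVelocity v) (x e₁ e₂ : ℝ) :
    g x e₂ - g x e₁ =
      (e₂ - e₁) * Real.exp (∫ s in (0 : ℝ)..x, meanSlope v (g s e₁) (g s e₂) s) := by
  simpa [hg.zero] using
    hv.sub_eq_mul_exp (hg.isGlobalSolution e₁) (hg.isGlobalSolution e₂) 0 x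

theorem strictMono (hg : IsGlobalFlow v g) (hv : IsRegularVelocity v) (x : ℝ) :
    StrictMono (g x) := fun e₁ e₂ h => by
  rw [← sub_pos, hg.sub_eq hv]
  exact mul_pos (sub_pos.2 h) (Real.exp_pos _)

theorem bijective (hg : IsGlobalFlow v g) (hv : IsRegularVelocity v) (x : ℝ) :
    Function.Bijective (g x) :=
  ⟨(hg.strictMono hv x).injective, hg.surjective x⟩

theorem continuous_uncurry (hg : IsGlobalFlow v g) (hv : IsRegularVelocity v) :
    Continuous (fun z : ℝ × ℝ => g z.1 z.2) :=
  continuous_uncurry_of_monotone (fun x => (hg.strictMono hv x).monotone)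
    (fun x => (hg.strictMono hv x).monotone.continuous_of_surjective (hg.surjective x))
    (fun e => (hg.isGlobalSolution e).continuous)

theorem continuous_inverse (hg : IsGlobalFlow v g) (hv : IsRegularVelocity v) {h : ℝ → ℝ → ℝ}
    (hgh : ∀ x y, g x (h x y) = y) : Continuous (fun z : ℝ × ℝ => h z.1 z.2) :=
  continuous_uncurry_inverse_of_strictMono (hg.strictMono hv)
    (fun e => (hg.isGlobalSolution e).continuous) hgh

theorem continuous_deriv_velocity (hg : IsGlobalFlow v g) (hv : IsRegularVelocity v) :
    Continuous (fun z : ℝ × ℝ => deriv (fun y => v y z.2) (g z.2 z.1)) :=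
  hv.continuous_deriv.comp (f := fun z : ℝ × ℝ => (g z.2 z.1, z.2))
    (((hg.continuous_uncurry hv).comp continuous_swap).prodMk continuous_snd)

theorem continuous_flowJacobian (hg : IsGlobalFlow v g) (hv : IsRegularVelocity v) :
    Continuous (fun z : ℝ × ℝ => flowJacobian v g z.1 z.2) :=
  Real.continuous_exp.comp <|
    intervalIntegral.continuous_parametric_intervalIntegral_of_continuous
      (f := fun (z : ℝ × ℝ) (s : ℝ) => deriv (fun y => v y s) (g s z.2))
      ((hg.continuous_deriv_velocity hv).comp
        (f := fun q : (ℝ × ℝ) × ℝ => (q.1.2, q.2)) (by fun_prop)) continuous_fst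

/-- By `sub_eq` the difference quotient is exactly an exponential of integrated mean slopes. It is
continuous in the second endpoint, and on the diagonal the mean slope is ∂_y v. -/
theorem hasDerivAt_state (hg : IsGlobalFlow v g) (hv : IsRegularVelocity v) (x e : ℝ) :
    HasDerivAt (g x) (flowJacobian v g x e) e := by
  rw [hasDerivAt_iff_tendsto_slope]
  have hgc := hg.continuous_uncurry hv
  have hc : Continuous (fun e' =>
      Real.exp (∫ s in (0 : ℝ)..x, meanSlope v (g s e) (g s e') s)) := by
    refine Real.continuous_exp.comp ?_
    refine intervalIntegral.continuous_parametric_intervalIntegral_of_continuous'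
      (f := fun e' s => meanSlope v (g s e) (g s e') s) ?_ 0 x
    refine hv.continuous_meanSlope.comp
      (f := fun q : ℝ × ℝ => (g q.2 e, g q.2 q.1, q.2)) ?_
    exact (hgc.comp (f := fun q : ℝ × ℝ => (q.2, e)) (by fun_prop)).prodMk
      ((hgc.comp (f := fun q : ℝ × ℝ => (q.2, q.1)) (by fun_prop)).prodMk continuous_snd)
  have ht := hc.tendsto e
  simp only [IsRegularVelocity.meanSlope_self] at ht
  refine (ht.mono_left nhdsWithin_le_nhds).congr' ?_
  filter_upwards [self_mem_nhdsWithin] with e' he'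
  rw [slope_def_field, hg.sub_eq hv, mul_div_cancel_left₀ _ (sub_ne_zero.2 he')]

theorem flowJacobian_zero (v g : ℝ → ℝ → ℝ) (e : ℝ) : flowJacobian v g 0 e = 1 := by
  simp [flowJacobian]

theorem measurable_fiberMap (hg : IsGlobalFlow v g) (hv : IsRegularVelocity v) :
    Measurable (fiberMap g) :=
  (continuous_fst.prodMk (hg.continuous_uncurry hv)).measurable

/-- Change of variables along the flow. -/
theorem map_fiberMap_withDensity (hg : IsGlobalFlow v g) (hv : IsRegularVelocity v)
    {F : ℝ × ℝ → ENNReal} (hF : Measurable F) :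
    (volume.withDensity (fun z : ℝ × ℝ =>
      F (fiberMap g z) * ENNReal.ofReal (flowJacobian v g z.1 z.2))).map (fiberMap g) =
      volume.withDensity F := by
  have hm := hg.measurable_fiberMap hv
  have hJ : Measurable (fun z : ℝ × ℝ => ENNReal.ofReal (flowJacobian v g z.1 z.2)) :=
    (hg.continuous_flowJacobian hv).measurable.ennreal_ofReal
  refine Measure.ext_of_lintegral _ fun φ hφ => ?_
  rw [lintegral_map hφ hm]
  change ∫⁻ z, (φ ∘ fiberMap g) z ∂(volume.withDensity ((F ∘ fiberMap g) *
    fun z : ℝ × ℝ => ENNReal.ofReal (flowJacobian v g z.1 z.2))) = _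
  rw [lintegral_withDensity_eq_lintegral_mul _ ((hF.comp hm).mul hJ) (hφ.comp hm),
    lintegral_withDensity_eq_lintegral_mul _ hF hφ, Measure.volume_eq_prod,
    lintegral_prod _ (((hF.comp hm).mul hJ).mul (hφ.comp hm)).aemeasurable,
    lintegral_prod _ (hF.mul hφ).aemeasurable]
  refine lintegral_congr fun x => ?_
  -- The first coordinate is fixed, so after Tonelli a one-dimensional substitution on each fiber
  -- suffices.
  have h := lintegral_image_eq_lintegral_deriv_mul_of_monotoneOn MeasurableSet.univ
    (fun e _ => (hg.hasDerivAt_state hv x e).hasDerivWithinAt)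
    ((hg.strictMono hv x).monotone.monotoneOn univ) (fun y => F (x, y) * φ (x, y))
  rw [image_univ, (hg.surjective x).range_eq, setLIntegral_univ, setLIntegral_univ] at h
  simp only [Pi.mul_apply]
  rw [h]
  refine lintegral_congr fun e => ?_
  simp only [fiberMap, Function.comp_apply]
  ring

/-- The flow carries measures on `ℝ²` injectively. -/
theorem map_fiberMap_injective (hg : IsGlobalFlow v g) (hv : IsRegularVelocity v)
    {μ ν : Measure (ℝ × ℝ)} (h : μ.map (fiberMap g) = ν.map (fiberMap g)) : μ = ν := by
  choose k hk using hg.surjective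
  have hkm : Measurable (fiberMap k) :=
    (continuous_fst.prodMk (hg.continuous_inverse hv hk)).measurable
  have hinv : fiberMap k ∘ fiberMap g = id := by
    ext z
    · rfl
    · exact (hg.strictMono hv z.1).injective (hk z.1 _)
  have := congrArg (Measure.map (fiberMap k)) h
  rwa [Measure.map_map hkm (hg.measurable_fiberMap hv),
    Measure.map_map hkm (hg.measurable_fiberMap hv), hinv, Measure.map_id, Measure.map_id] at this

end IsGlobalFlow

/-! ### Conditional densities and their transport -/

namespace IsScoreDensity

variable {P : Measure (ℝ × ℝ)} {p : ℝ × ℝ → ℝ}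

theorem marginalDensity_pos (hp : IsScoreDensity P p) (x : ℝ) : 0 < marginalDensity p x := by
  unfold marginalDensity
  rw [integral_pos_iff_support_of_nonneg (fun y => (hp.pos (x, y)).le) (hp.integrable_section x)]
  rw [show Function.support (fun y => p (x, y)) = univ from
    eq_univ_of_forall fun y => (hp.pos (x, y)).ne']
  simp

theorem conditionalDensity_pos (hp : IsScoreDensity P p) (z : ℝ × ℝ) :
    0 < conditionalDensity p z :=
  div_pos (hp.pos z) (hp.marginalDensity_pos z.1)

theorem eq_mul (hp : IsScoreDensity P p) (z : ℝ × ℝ) :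
    p z = marginalDensity p z.1 * conditionalDensity p z :=
  (mul_div_cancel₀ _ (hp.marginalDensity_pos z.1).ne').symm

theorem continuous (hp : IsScoreDensity P p) : Continuous p :=
  (Real.continuous_exp.comp hp.differentiable_log_joint.continuous).congr
    fun z => Real.exp_log (hp.pos z)

theorem continuous_marginalDensity (hp : IsScoreDensity P p) : Continuous (marginalDensity p) :=
  (Real.continuous_exp.comp hp.differentiable_log_marginal.continuous).congr
    fun x => Real.exp_log (hp.marginalDensity_pos x)

theorem continuous_conditionalDensity (hp : IsScoreDensity P p) :
    Continuous (conditionalDensity p) :=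
  (Real.continuous_exp.comp hp.differentiable_log_conditional.continuous).congr
    fun z => Real.exp_log (hp.conditionalDensity_pos z)

theorem isProbabilityMeasure_marginal [IsProbabilityMeasure P] (hp : IsScoreDensity P p) :
    IsProbabilityMeasure
      (volume.withDensity (fun x => ENNReal.ofReal (marginalDensity p x))) := by
  refine ⟨?_⟩
  have h : P univ = 1 := measure_univ
  rw [hp.eq_withDensity, withDensity_apply _ MeasurableSet.univ, setLIntegral_univ,
    Measure.volume_eq_prod,
    lintegral_prod _ hp.continuous.measurable.ennreal_ofReal.aemeasurable] at h
  rw [withDensity_apply _ MeasurableSet.univ, setLIntegral_univ, ← h]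
  exact lintegral_congr fun x => ofReal_integral_eq_lintegral_ofReal (hp.integrable_section x)
    (.of_forall fun y => (hp.pos (x, y)).le)

theorem isProbabilityMeasure_conditional (hp : IsScoreDensity P p) (x : ℝ) :
    IsProbabilityMeasure
      (volume.withDensity (fun y => ENNReal.ofReal (conditionalDensity p (x, y)))) := by
  refine ⟨?_⟩
  rw [withDensity_apply _ MeasurableSet.univ, setLIntegral_univ,
    ← ofReal_integral_eq_lintegral_ofReal (f := fun y => conditionalDensity p (x, y))
      ((hp.integrable_section x).div_const (marginalDensity p x)) (.of_forall fun y => (hp.conditionalDensity_pos (x, y)).le)]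
  simp only [conditionalDensity, integral_div]
  rw [← marginalDensity, div_self (hp.marginalDensity_pos x).ne', ENNReal.ofReal_one]

theorem jointScoreX_eq (hp : IsScoreDensity P p) (x y : ℝ) :
    jointScoreX p x y =
      deriv (fun t => Real.log (conditionalDensity p (t, y))) x + marginalScore p x := by
  have h1 : DifferentiableAt ℝ (fun t => Real.log (conditionalDensity p (t, y))) x :=
    (hp.differentiable_log_conditional (x, y)).comp x
      (f := fun t : ℝ => (t, y)) (by fun_prop)
  unfold jointScoreX marginalScore
  rw [← deriv_fun_add h1 (hp.differentiable_log_marginal x)]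
  congr 1
  ext t
  rw [hp.eq_mul, Real.log_mul (hp.marginalDensity_pos t).ne' (hp.conditionalDensity_pos _).ne',
    add_comm]

theorem jointScoreY_eq (hp : IsScoreDensity P p) (x y : ℝ) :
    jointScoreY p x y = deriv (fun t => Real.log (conditionalDensity p (x, t))) y := by
  unfold jointScoreY
  have : (fun t => Real.log (p (x, t))) = fun t =>
      Real.log (marginalDensity p x) + Real.log (conditionalDensity p (x, t)) := by
    ext t
    rw [hp.eq_mul, Real.log_mul (hp.marginalDensity_pos x).ne' (hp.conditionalDensity_pos _).ne']
  rw [this, deriv_const_add]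

/-- The logarithmic derivative, along a solution, of the conditional density times the Jacobian of
the flow. -/
theorem hasDerivAt_log_along_flow (hp : IsScoreDensity P p) {v g : ℝ → ℝ → ℝ}
    (hv : IsRegularVelocity v) (hg : IsGlobalFlow v g) (x e : ℝ) :
    HasDerivAt
      (fun t => Real.log (conditionalDensity p (t, g t e) * flowJacobian v g t e))
      (jointScoreX p x (g x e) - marginalScore p x + v (g x e) x * jointScoreY p x (g x e) +
        deriv (fun y => v y x) (g x e)) x := by
  have hlog : (fun t => Real.log (conditionalDensity p (t, g t e) * flowJacobian v g t e)) =
      fun t => Real.log (conditionalDensity p (t, g t e)) +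
        ∫ s in (0 : ℝ)..t, deriv (fun y => v y s) (g s e) := by
    ext t
    rw [flowJacobian, Real.log_mul (hp.conditionalDensity_pos _).ne' (Real.exp_pos _).ne',
      Real.log_exp]
  have hcd : Continuous (fun s => deriv (fun y => v y s) (g s e)) :=
    (hg.continuous_deriv_velocity hv).comp (f := fun s : ℝ => (e, s)) (by fun_prop)
  have hJ := (hcd.integral_hasStrictDerivAt 0 x).hasDerivAt
  set y := g x e with hy
  -- Joint differentiability gives the chain rule along the curve (t, g t e), whose tangent is (1,
  -- v).
  have hL := (hp.differentiable_log_conditional (x, y)).hasFDerivAt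
  set L := fderiv ℝ (fun z => Real.log (conditionalDensity p z)) (x, y) with hLdef
  have hX : deriv (fun t => Real.log (conditionalDensity p (t, y))) x = L (1, 0) :=
    (HasFDerivAt.comp_hasDerivAt (f := fun t : ℝ => (t, y)) x hL
      ((hasDerivAt_id x).prodMk (hasDerivAt_const x y))).deriv
  have hY : deriv (fun t => Real.log (conditionalDensity p (x, t))) y = L (0, 1) :=
    (HasFDerivAt.comp_hasDerivAt (f := fun t : ℝ => (x, t)) y hL
      ((hasDerivAt_const y x).prodMk (hasDerivAt_id y))).deriv
  have hcurve : HasDerivAt (fun t => Real.log (conditionalDensity p (t, g t e)))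
      (L (1, v y x)) x :=
    HasFDerivAt.comp_hasDerivAt (f := fun t : ℝ => (t, g t e)) x hL
      ((hasDerivAt_id x).prodMk (hg.isGlobalSolution e x))
  have hsplit : L (1, v y x) = L (1, 0) + v y x * L (0, 1) := by
    rw [← smul_eq_mul, ← map_smul, ← map_add]
    simp
  rw [hlog, hp.jointScoreX_eq, hp.jointScoreY_eq, hX, hY, add_sub_cancel_right, ← hsplit]
  exact hcurve.add hJ

/-- The score equation says that the flow transports the conditional densities. -/
theorem score_eq_iff_transport (hp : IsScoreDensity P p) {v g : ℝ → ℝ → ℝ}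
    (hv : IsRegularVelocity v) (hg : IsGlobalFlow v g) :
    (∀ x y : ℝ, jointScoreX p x y =
        -deriv (fun t => v t x) y - v y x * jointScoreY p x y + marginalScore p x) ↔
      ∀ x e, conditionalDensity p (x, g x e) * flowJacobian v g x e =
        conditionalDensity p (0, e) := by
  have hpos : ∀ x e, 0 < conditionalDensity p (x, g x e) * flowJacobian v g x e := fun x e =>
    mul_pos (hp.conditionalDensity_pos _) (Real.exp_pos _)
  constructor
  · intro h x e
    have hc := is_const_of_deriv_eq_zero
      (fun t => (hp.hasDerivAt_log_along_flow hv hg t e).differentiableAt)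
      (fun t => by rw [(hp.hasDerivAt_log_along_flow hv hg t e).deriv, h]; ring) x 0
    rw [hg.zero, IsGlobalFlow.flowJacobian_zero, mul_one] at hc
    exact Real.log_injOn_pos (hpos x e) (hp.conditionalDensity_pos _) hc
  · intro h x y
    -- Every point lies on a trajectory, where the transported quantity is constant.
    obtain ⟨e, rfl⟩ := hg.surjective x y
    have hd := hp.hasDerivAt_log_along_flow hv hg x e
    simp only [h] at hd
    have := hd.unique (hasDerivAt_const x _)
    linarith

/-- The joint law, pulled back by the flow. -/
theorem map_withDensity_pullback (hp : IsScoreDensity P p) {v g : ℝ → ℝ → ℝ}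
    (hv : IsRegularVelocity v) (hg : IsGlobalFlow v g) :
    (volume.withDensity (fun z : ℝ × ℝ => ENNReal.ofReal (marginalDensity p z.1) *
      ENNReal.ofReal (conditionalDensity p (fiberMap g z) * flowJacobian v g z.1 z.2))).map
        (fiberMap g) = P := by
  rw [hp.eq_withDensity,
    ← hg.map_fiberMap_withDensity hv hp.continuous.measurable.ennreal_ofReal]
  congr 2
  ext z
  rw [hp.eq_mul (fiberMap g z), ENNReal.ofReal_mul (hp.marginalDensity_pos _).le,
    ENNReal.ofReal_mul (hp.conditionalDensity_pos _).le, mul_assoc]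
  rfl

end IsScoreDensity

/-! ### Rigidity of product densities -/

/-- If a measure on `ℝ²` with density `m(x) k(x, e)` is a product whose first factor is the
probability law with density `m > 0`, then the continuous function `k` does not depend on `x`. -/
theorem eq_of_prod_eq_withDensity {m : ℝ → ℝ} {k : ℝ × ℝ → ℝ} {ν : Measure ℝ} [SFinite ν]
    (hm : Measurable m) (hmpos : ∀ x, 0 < m x) (hk : Continuous k) (hkpos : ∀ z, 0 < k z)
    [IsProbabilityMeasure (volume.withDensity fun x => ENNReal.ofReal (m x))]
    (h : (volume.withDensity fun x => ENNReal.ofReal (m x)).prod ν =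
      volume.withDensity fun z : ℝ × ℝ => ENNReal.ofReal (m z.1) * ENNReal.ofReal (k z))
    (x x' e : ℝ) : k (x, e) = k (x', e) := by
  have hmm : Measurable (fun x => ENNReal.ofReal (m x)) := hm.ennreal_ofReal
  have hD : Measurable (fun z : ℝ × ℝ => ENNReal.ofReal (m z.1) * ENNReal.ofReal (k z)) :=
    (hmm.comp measurable_fst).mul hk.measurable.ennreal_ofReal
  set d : ℝ → ENNReal := fun e => ∫⁻ x, ENNReal.ofReal (m x) * ENNReal.ofReal (k (x, e)) with hd
  have hdm : Measurable d := hD.lintegral_prod_left'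
  have hν : ν = volume.withDensity d := by
    ext B hB
    have h1 := congrArg (fun μ : Measure (ℝ × ℝ) => μ (univ ×ˢ B)) h
    simp only [Measure.prod_prod, measure_univ, one_mul] at h1
    rw [h1, withDensity_apply _ (MeasurableSet.univ.prod hB), withDensity_apply _ hB,
      Measure.volume_eq_prod, ← Measure.prod_restrict, Measure.restrict_univ,
      lintegral_prod_symm _ hD.aemeasurable]
  rw [hν, prod_withDensity hmm hdm, ← Measure.volume_eq_prod,
    withDensity_eq_iff_of_sigmaFinite
      (f := fun z : ℝ × ℝ => ENNReal.ofReal (m z.1) * d z.2)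
      ((hmm.comp measurable_fst).mul (hdm.comp measurable_snd)).aemeasurable hD.aemeasurable,
    Measure.volume_eq_prod] at h
  -- Since d is only measurable, the quantifiers are swapped: for almost every e, continuity in x
  -- removes the exceptional x; continuity of k in e then removes the exceptional e.
  have hae : ∀ᵐ e, ∀ᵐ x, d e = ENNReal.ofReal (k (x, e)) := by
    refine (Measure.ae_ae_comm (measurableSet_eq_fun
      (f := fun z : ℝ × ℝ => d z.2) (g := fun z => ENNReal.ofReal (k z))
      (hdm.comp measurable_snd) hk.measurable.ennreal_ofReal)).1 ?_
    filter_upwards [Measure.ae_ae_of_ae_prod h] with x hx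
    filter_upwards [hx] with e he
    exact (ENNReal.mul_right_inj (ENNReal.ofReal_pos.2 (hmpos x)).ne' ENNReal.ofReal_ne_top).1 he
  have hkx : ∀ x, Continuous fun e => k (x, e) := fun x => hk.comp (by fun_prop)
  have hke : ∀ e, Continuous fun x => k (x, e) := fun e => hk.comp (by fun_prop)
  refine congrFun ((Continuous.ae_eq_iff_eq volume (hkx x) (hkx x')).1 ?_) e
  filter_upwards [hae] with e he
  have hall := (Continuous.ae_eq_iff_eq volume continuous_const
    (ENNReal.continuous_ofReal.comp (hke e))).1 he
  have h1 := (congrFun hall x).symm.trans (congrFun hall x')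
  exact (ENNReal.ofReal_eq_ofReal_iff (hkpos _).le (hkpos _).le).1 h1

/-! ### SCMs as flows -/

namespace BijectiveSCM

theorem mechanism_symm (M : BijectiveSCM) (x y : ℝ) :
    M.mechanism x ((Equiv.ofBijective _ (M.bijective_mechanism x)).symm y) = y :=
  (Equiv.ofBijective _ (M.bijective_mechanism x)).apply_symm_apply y

theorem flow_mechanism (M : BijectiveSCM) (x x' ε : ℝ) :
    M.flow x x' (M.mechanism x ε) = M.mechanism x' ε :=
  congrArg (M.mechanism x') ((Equiv.ofBijective _ (M.bijective_mechanism x)).symm_apply_apply ε)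

/-- Restarting the flow at φ_{0,t}(e) continues the same curve, so the velocity condition at x' = x
becomes the differential equation. -/
theorem HasVelocity.isGlobalFlow {M : BijectiveSCM} {v : ℝ → ℝ → ℝ} (hM : M.HasVelocity v) :
    IsGlobalFlow v (M.flow 0) where
  zero e := M.mechanism_symm 0 e
  isGlobalSolution e t := by
    have h := hM.2 t (M.flow 0 t e)
    simpa only [flow, flow_mechanism, Equiv.ofBijective_symm_apply_apply] using h
  surjective t y := by
    obtain ⟨ε, rfl⟩ := (M.bijective_mechanism t).surjective y
    exact ⟨M.mechanism 0 ε, M.flow_mechanism 0 t ε⟩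

/-- Replacing ε by f_0(ε) turns the mechanism into the flow from 0 and keeps the noise independent
of the cause. -/
theorem jointLaw_eq_map_fiberMap (M : BijectiveSCM) (hm : Measurable (fiberMap (M.flow 0))) :
    M.jointLaw =
      (M.causeLaw.prod (M.noiseLaw.map (M.mechanism 0))).map (fiberMap (M.flow 0)) := by
  have := M.isProbabilityMeasure_causeLaw
  have := M.isProbabilityMeasure_noiseLaw
  have h0 : Measurable (M.mechanism 0) :=
    M.measurable_mechanism.comp (g := fun z : ℝ × ℝ => M.mechanism z.1 z.2) measurable_prodMk_left
  have h1 := Measure.map_prod_map M.causeLaw M.noiseLaw measurable_id h0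
  rw [Measure.map_id] at h1
  rw [h1, Measure.map_map hm (measurable_id.prodMap h0), jointLaw]
  congr 1
  ext z
  · rfl
  · exact (M.flow_mechanism 0 z.1 z.2).symm

/-- The SCM whose mechanism is a given flow. -/
noncomputable def ofGlobalFlow {v g : ℝ → ℝ → ℝ} (hv : IsRegularVelocity v)
    (hg : IsGlobalFlow v g) (μ ν : Measure ℝ) (hμ : IsProbabilityMeasure μ)
    (hν : IsProbabilityMeasure ν) : BijectiveSCM where
  mechanism := g
  measurable_mechanism := (hg.continuous_uncurry hv).measurable
  bijective_mechanism := hg.bijective hv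
  causeLaw := μ
  noiseLaw := ν
  isProbabilityMeasure_causeLaw := hμ
  isProbabilityMeasure_noiseLaw := hν

theorem hasVelocity_ofGlobalFlow {v g : ℝ → ℝ → ℝ} (hv : IsRegularVelocity v)
    (hg : IsGlobalFlow v g) (μ ν : Measure ℝ) (hμ : IsProbabilityMeasure μ)
    (hν : IsProbabilityMeasure ν) : (ofGlobalFlow hv hg μ ν hμ hν).HasVelocity v := by
  set M := ofGlobalFlow hv hg μ ν hμ hν
  have hinv := hg.continuous_inverse hv (h := fun x y =>
    (Equiv.ofBijective _ (M.bijective_mechanism x)).symm y) M.mechanism_symm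
  refine ⟨(hg.continuous_uncurry hv).comp (f := fun q : ℝ × ℝ × ℝ => (q.2.1,
    (Equiv.ofBijective _ (M.bijective_mechanism q.1)).symm q.2.2)) ?_, fun x y => ?_⟩
  · exact (continuous_fst.comp continuous_snd).prodMk
      (hinv.comp (f := fun q : ℝ × ℝ × ℝ => (q.1, q.2.2)) (by fun_prop))
  · have h := hg.isGlobalSolution ((Equiv.ofBijective _ (M.bijective_mechanism x)).symm y) x
    have hy : g x ((Equiv.ofBijective _ (M.bijective_mechanism x)).symm y) = y :=
      M.mechanism_symm x y
    simp only [hy] at h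
    exact h

end BijectiveSCM

/-! ### The equivalence -/

theorem theorem2 (P : Measure (ℝ × ℝ)) [IsProbabilityMeasure P] (p : ℝ × ℝ → ℝ)
    (hp : IsScoreDensity P p) (v : ℝ → ℝ → ℝ) (hv : IsRegularVelocity v) :
    (∀ x y : ℝ, jointScoreX p x y =
        -deriv (fun t => v t x) y - v y x * jointScoreY p x y + marginalScore p x) ↔
      ∃ M : BijectiveSCM, M.jointLaw = P ∧ M.HasVelocity v ∧
        M.causeLaw = volume.withDensity (fun x => ENNReal.ofReal (marginalDensity p x)) := by
  have hmarg := hp.isProbabilityMeasure_marginal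
  constructor
  · intro hscore
    obtain ⟨g, hg⟩ := hv.exists_isGlobalFlow
    have htr := (hp.score_eq_iff_transport hv hg).1 hscore
    refine ⟨BijectiveSCM.ofGlobalFlow hv hg _ _ hmarg (hp.isProbabilityMeasure_conditional 0), ?_,
      BijectiveSCM.hasVelocity_ofGlobalFlow hv hg _ _ _ _, rfl⟩
    refine Eq.trans ?_ (hp.map_withDensity_pullback hv hg)
    have h0 : Continuous fun e => conditionalDensity p (0, e) :=
      hp.continuous_conditionalDensity.comp (by fun_prop)
    refine (congrArg (Measure.map (fiberMap g)) (prod_withDensity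
      hp.continuous_marginalDensity.measurable.ennreal_ofReal
      h0.measurable.ennreal_ofReal)).trans ?_
    rw [← Measure.volume_eq_prod]
    congr 2
    ext z
    rw [← htr z.1 z.2]
    rfl
  · rintro ⟨M, hjoint, hvel, hcause⟩
    have hg := hvel.isGlobalFlow
    refine (hp.score_eq_iff_transport hv hg).2 fun x e => ?_
    have := M.isProbabilityMeasure_noiseLaw
    rw [M.jointLaw_eq_map_fiberMap (hg.measurable_fiberMap hv), hcause,
      ← hp.map_withDensity_pullback hv hg] at hjoint
    have h := eq_of_prod_eq_withDensity (m := marginalDensity p)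
      (k := fun z => conditionalDensity p (fiberMap (M.flow 0) z) *
        flowJacobian v (M.flow 0) z.1 z.2)
      hp.continuous_marginalDensity.measurable hp.marginalDensity_pos
      ((hp.continuous_conditionalDensity.comp
        (continuous_fst.prodMk (hg.continuous_uncurry hv))).mul (hg.continuous_flowJacobian hv))
      (fun z => mul_pos (hp.conditionalDensity_pos _) (Real.exp_pos _))
      (hg.map_fiberMap_injective hv hjoint) x 0 e
    simpa only [fiberMap, hg.zero, IsGlobalFlow.flowJacobian_zero, mul_one] using h
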